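/- Let $d\ge 0$ and let $P, Q$ be Borel probability measures on $\mathbb{R}^d$ with $P \ll Q$, finite relative entropy $R(P\|Q)=\int \log\frac{dP}{dQ}\,dP<\infty$, finite first moments $\int\|x\|_2\,dP<\infty$ and $\int\|x\|_2\,dQ<\infty$, and with $Q$ sub-Gaussian: for every unit vector $u\in\mathbb{R}^d$ there is $K>0$ such that $Q(\{x:|u^{T}x|\ge t\})\le 2e^{-t^2/K^2}$ for all $t\ge 0$. For widths $l_1,l_2$ let $T_\theta:\mathbb{R}^d\to\mathbb{R}$ be the fully connected ReLU network with two hidden layers of widths $l_1$ and $l_2$ and with an affine output node, where $\theta\in\mathbb{R}^N$, $N=l_1d+l_1+l_1l_2+2l_2+1$, collects all weights and biases: $$T_\theta(x)=c+\sum_{k=1}^{l_2}\lambda_k\Big(b_k+\sum_{i=1}^{l_1}\alpha_{ki}\,(\beta_i^{T}x+\gamma_i)^+\Big)^+,\qquad \theta=(\beta,\gamma,\alpha,b,\lambda,c).$$ For $\Theta\subseteq\mathbb{R}^N$ let $\mathcal{F}_\Theta=\{T_\theta:\theta\in\Theta\}$. Given sample points $X_1,X_2,\dots$ and $Y_1,Y_2,\dots$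 in $\mathbb{R}^d$, the empirical Donsker–Varadhan estimate is $$\tilde R_{n,m}(\mathcal{F}_\Theta)=\sup_{T\in\mathcal{F}_\Theta}\Big(\frac1n\sum_{i=1}^n T(X_i)-\log\Big(\frac1m\sum_{j=1}^m e^{T(Y_j)}\Big)\Big).$$ Then for every $\varepsilon>0$ there are $L_1,L_2$ such that for all widths $l_1\ge L_1$, $l_2\ge L_2$ there is a nonempty compact set $\Theta_0\subset\mathbb{R}^N$ such that for every compact $\Theta\supseteq\Theta_0$ (in particular for $\Theta=\Theta_0$) the following holds. If $X_1,X_2,\dots$ are i.i.d. with law $P$ and $Y_1,Y_2,\dots$ are i.i.d. with law $Q$, all defined on one probability space, then almost surely $$\limsup_{n,m\to\infty}\big|R(P\|Q)-\tilde R_{n,m}(\mathcal{F}_\Theta)\big|<\varepsilon,$$ where $n$ and $m$ tend to infinity jointly and independently of each other. -/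

import Mathlib

open MeasureTheory ProbabilityTheory Filter
open scoped ENNReal

noncomputable section

/-- A real random variable `Z` on `(Ω, μ)` is sub-Gaussian (no centering required) if
`μ(|Z| ≥ t) ≤ 2 exp(-t² / K²)` for all `t ≥ 0`, for some constant `K > 0`. -/
def IsSubGaussianVar {Ω : Type*} [MeasurableSpace Ω] (Z : Ω → ℝ) (μ : Measure Ω) : Prop :=
  ∃ K : ℝ, 0 < K ∧ ∀ t : ℝ, 0 ≤ t → μ.real {ω | t ≤ |Z ω|} ≤ 2 * Real.exp (-(t ^ 2 / K ^ 2))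

/-- A measure on `ℝ^d` is sub-Gaussian if every one-dimensional marginal `x ↦ uᵀ x`, `‖u‖ = 1`,
is a sub-Gaussian random variable. -/
def IsSubGaussianMeasure {d : ℕ} (Q : Measure (EuclideanSpace ℝ (Fin d))) : Prop :=
  ∀ u : EuclideanSpace ℝ (Fin d), ‖u‖ = 1 → IsSubGaussianVar (fun x => inner ℝ u x) Q

/-- The ReLU activation function `z ↦ z⁺`. -/
def relu (z : ℝ) : ℝ := max z 0

/-- Names of the real parameters of a fully connected network `ℝ^d → ℝ` with two hidden layers, of
widths `l₁` and `l₂`: weights and biases of the first hidden layer, of the second hidden layer, and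
of the output node. There are `N = l₁ d + l₁ + l₂ l₁ + l₂ + l₂ + 1` of them. -/
inductive ParamIndex (d l₁ l₂ : ℕ) : Type
  | weight₁ (i : Fin l₁) (j : Fin d)
  | bias₁ (i : Fin l₁)
  | weight₂ (k : Fin l₂) (i : Fin l₁)
  | bias₂ (k : Fin l₂)
  | weightOut (k : Fin l₂)
  | biasOut

/-- The parameter space `ℝ^N`, with its usual (product) topology. -/
abbrev ParamSpace (d l₁ l₂ : ℕ) : Type := ParamIndex d l₁ l₂ → ℝ

/-- Activation of the `i`-th node of the first hidden layer. -/
def hidden₁ {d l₁ l₂ : ℕ} (θ : ParamSpace d l₁ l₂) (x : EuclideanSpace ℝ (Fin d))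
    (i : Fin l₁) : ℝ :=
  relu (∑ j, θ (.weight₁ i j) * x j + θ (.bias₁ i))

/-- Activation of the `k`-th node of the second hidden layer. -/
def hidden₂ {d l₁ l₂ : ℕ} (θ : ParamSpace d l₁ l₂) (x : EuclideanSpace ℝ (Fin d))
    (k : Fin l₂) : ℝ :=
  relu (∑ i, θ (.weight₂ k i) * hidden₁ θ x i + θ (.bias₂ k))

/-- The two-hidden-layer ReLU network `T_θ : ℝ^d → ℝ` (with affine output node). -/
def network {d l₁ l₂ : ℕ} (θ : ParamSpace d l₁ l₂) (x : EuclideanSpace ℝ (Fin d)) : ℝ :=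
  ∑ k, θ (.weightOut k) * hidden₂ θ x k + θ .biasOut

/-- The class `F_Θ = {T_θ : θ ∈ Θ}`. -/
def networkClass {d l₁ l₂ : ℕ} (Θ : Set (ParamSpace d l₁ l₂)) :
    Set (EuclideanSpace ℝ (Fin d) → ℝ) :=
  network '' Θ

/-- The expectation of `g` under the empirical measure of the points `x 0, …, x (n - 1)`. -/
def empiricalMean {E : Type*} (x : ℕ → E) (n : ℕ) (g : E → ℝ) : ℝ :=
  (∑ i ∈ Finset.range n, g (x i)) / n

/-- The empirical Donsker-Varadhan estimate
`R̃_{n,m}(F) = sup_{T ∈ F} (E^{P_n}[T] - log E^{Q_m}[exp T])`, where `P_n` and `Q_m` are the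
empirical measures of the first `n` points of `x` and the first `m` points of `y`. The supremum is
taken in `[-∞, ∞]`. -/
def empiricalDV {E : Type*} (x y : ℕ → E) (n m : ℕ) (F : Set (E → ℝ)) : EReal :=
  ⨆ T ∈ F, ((empiricalMean x n T - Real.log (empiricalMean y m fun z => Real.exp (T z)) : ℝ) : EReal)

end

/-! The estimate is squeezed by the Donsker-Varadhan formula. From above, `∫ T dP - log ∫ exp T dQ ≤
R(P‖Q)` for every network `T`, because the gap is the relative entropy of `P` with respect to
`Q.tilted T`. From below, a single network comes within `ε / 2` of `R(P‖Q)`. Its parameter alone is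
`Θ₀`: a larger `Θ` raises the supremum, but not past the upper bound.

The near-optimal network (`exists_deepNetwork_klDiv_sub_lt`) arises from the log of a truncated
density, approximated in `L¹(P + Q)` by a function in `C_c`, and that one uniformly by networks
(`exists_deepNetwork_near`). For the last step, convolve with a small bump. A translated bump is one
node of the second layer, and the convolution is a Bochner integral of translates, hence in the
closed span of networks.

To pass to samples, regard `θ ↦ T_θ(x)` and `θ ↦ exp (T_θ(x))` as random elements of the Banach
space `C(Θ, ℝ)`. Networks grow linearly, uniformly over compact `Θ`, so the first is integrable by
the first moment of `P` and the second by the exponential moments of `Q`. The strong law in `C(Θ,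
ℝ)` is then uniform in `θ`, separately in `n` and `m`. -/

/-! ### Vector spaces of network functions. -/

/-- The functions `ℝ^d → ℝ` which are linear combinations of `l` ReLU ridge functions, for all
sufficiently large `l`. -/
def shallowNetworks (d : ℕ) : Submodule ℝ (EuclideanSpace ℝ (Fin d) → ℝ) where
  carrier := {f | ∃ L, ∀ l, L ≤ l → ∃ (w : Fin l → Fin d → ℝ) (c a : Fin l → ℝ),
    f = fun x => ∑ i, a i * relu (∑ j, w i j * x j + c i)}
  zero_mem' := ⟨0, fun l _ => ⟨0, 0, 0, by ext; simp⟩⟩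
  add_mem' := by
    rintro f g ⟨L, hf⟩ ⟨M, hg⟩
    refine ⟨L + M, fun l hl => ?_⟩
    obtain ⟨m, rfl⟩ := Nat.exists_eq_add_of_le (le_of_add_le_left hl)
    obtain ⟨w, c, a, rfl⟩ := hf L le_rfl
    obtain ⟨w', c', a', rfl⟩ := hg m (by omega)
    refine ⟨Fin.append w w', Fin.append c c', Fin.append a a', ?_⟩
    ext x
    simp [Fin.sum_univ_add]
  smul_mem' := by
    rintro r f ⟨L, hf⟩
    refine ⟨L, fun l hl => ?_⟩
    obtain ⟨w, c, a, rfl⟩ := hf l hl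
    refine ⟨w, c, r • a, ?_⟩
    ext x
    simp [Finset.mul_sum, mul_assoc]

/-- The functions `ℝ^d → ℝ` which are computed by a network with two hidden layers, for all
sufficiently large widths of the layers. -/
def deepNetworks (d : ℕ) : Submodule ℝ (EuclideanSpace ℝ (Fin d) → ℝ) where
  carrier := {f | ∃ L₁ L₂, ∀ l₁ l₂, L₁ ≤ l₁ → L₂ ≤ l₂ →
    ∃ θ : ParamSpace d l₁ l₂, network θ = f}
  zero_mem' := ⟨0, 0, fun l₁ l₂ _ _ => ⟨0, by ext; simp [network]⟩⟩
  add_mem' := by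
    rintro f g ⟨L₁, L₂, hf⟩ ⟨M₁, M₂, hg⟩
    refine ⟨L₁ + M₁, L₂ + M₂, fun l₁ l₂ h₁ h₂ => ?_⟩
    obtain ⟨m₁, rfl⟩ := Nat.exists_eq_add_of_le (le_of_add_le_left h₁)
    obtain ⟨m₂, rfl⟩ := Nat.exists_eq_add_of_le (le_of_add_le_left h₂)
    obtain ⟨θ, rfl⟩ := hf L₁ L₂ le_rfl le_rfl
    obtain ⟨θ', rfl⟩ := hg m₁ m₂ (by omega) (by omega)
    refine ⟨fun p => match p with
      | .weight₁ i j => Fin.append (fun i => θ (.weight₁ i j)) (fun i => θ' (.weight₁ i j)) i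
      | .bias₁ i => Fin.append (fun i => θ (.bias₁ i)) (fun i => θ' (.bias₁ i)) i
      -- Block-diagonal weights: the two networks run side by side without interacting.
      | .weight₂ k i => Fin.append (fun k => Fin.append (fun i => θ (.weight₂ k i)) 0 i)
          (fun k => Fin.append 0 (fun i => θ' (.weight₂ k i)) i) k
      | .bias₂ k => Fin.append (fun k => θ (.bias₂ k)) (fun k => θ' (.bias₂ k)) k
      | .weightOut k => Fin.append (fun k => θ (.weightOut k)) (fun k => θ' (.weightOut k)) k
      | .biasOut => θ .biasOut + θ' .biasOut, ?_⟩
    ext x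
    simp [network, hidden₂, hidden₁, Fin.sum_univ_add]
    ring
  smul_mem' := by
    rintro r f ⟨L₁, L₂, hf⟩
    refine ⟨L₁, L₂, fun l₁ l₂ h₁ h₂ => ?_⟩
    obtain ⟨θ, rfl⟩ := hf l₁ l₂ h₁ h₂
    refine ⟨fun p => match p with
      | .weight₁ i j => θ (.weight₁ i j)
      | .bias₁ i => θ (.bias₁ i)
      | .weight₂ k i => θ (.weight₂ k i)
      | .bias₂ k => θ (.bias₂ k)
      | .weightOut k => r * θ (.weightOut k)
      | .biasOut => r * θ .biasOut, ?_⟩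
    ext x
    simp [network, hidden₂, hidden₁, Finset.mul_sum, mul_assoc, mul_add]

lemma ridge_mem_shallowNetworks {d : ℕ} (w : Fin d → ℝ) (c : ℝ) :
    (fun x : EuclideanSpace ℝ (Fin d) => relu (∑ j, w j * x j + c)) ∈ shallowNetworks d := by
  refine ⟨1, fun l hl => ⟨fun _ => w, fun _ => c, Pi.single ⟨0, hl⟩ 1, ?_⟩⟩
  ext x
  rw [Finset.sum_eq_single (⟨0, hl⟩ : Fin l)]
  · simp
  · intro i _ hi
    simp [Pi.single_eq_of_ne hi]
  · simp

lemma relu_add_relu_neg (t : ℝ) : relu t + relu (-t) = |t| := by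
  rcases le_total 0 t with h | h
  · simp [relu, h, abs_of_nonneg h]
  · simp [relu, h, abs_of_nonpos h]

lemma abs_coord_sub_mem_shallowNetworks {d : ℕ} (j : Fin d) (c : ℝ) :
    (fun x : EuclideanSpace ℝ (Fin d) => |x j - c|) ∈ shallowNetworks d := by
  convert add_mem (ridge_mem_shallowNetworks (Pi.single j 1) (-c))
    (ridge_mem_shallowNetworks (-Pi.single j 1) c) using 1
  ext x
  simp only [Pi.add_apply, Pi.neg_apply, neg_mul, Finset.sum_neg_distrib, Pi.single_apply, ite_mul,
    one_mul, zero_mul, Finset.sum_ite_eq', Finset.mem_univ, if_true]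
  rw [← relu_add_relu_neg, neg_sub, ← sub_eq_add_neg, neg_add_eq_sub]

/-- One second-layer node suffices; the spare nodes get output weight zero. -/
lemma relu_shallow_mem_deepNetworks {d : ℕ} {f : EuclideanSpace ℝ (Fin d) → ℝ}
    (hf : f ∈ shallowNetworks d) (b : ℝ) : (fun x => relu (f x + b)) ∈ deepNetworks d := by
  obtain ⟨L, hf⟩ := hf
  refine ⟨L, 1, fun l₁ l₂ h₁ h₂ => ?_⟩
  obtain ⟨w, c, a, rfl⟩ := hf l₁ h₁
  refine ⟨fun p => match p with
    | .weight₁ i j => w i j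
    | .bias₁ i => c i
    | .weight₂ _ i => a i
    | .bias₂ _ => b
    | .weightOut k => (Pi.single ⟨0, h₂⟩ 1 : Fin l₂ → ℝ) k
    | .biasOut => 0, ?_⟩
  ext x
  simp only [network, hidden₂, hidden₁]
  rw [Finset.sum_eq_single ⟨0, h₂⟩]
  · simp
  · intro i _ hi
    simp [Pi.single_eq_of_ne hi]
  · simp

/-! ### Bumps and uniform density in `C_c(ℝ^d)`. -/

/-- A piecewise linear bump supported in the `ℓ¹`-ball of radius `1 / N`. -/
def bump {d : ℕ} (N : ℝ) (x : EuclideanSpace ℝ (Fin d)) : ℝ :=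
  relu (1 - N * ∑ j, |x j|)

lemma bump_sub_mem_deepNetworks {d : ℕ} (N : ℝ) (c : EuclideanSpace ℝ (Fin d)) :
    (fun x => bump N (x - c)) ∈ deepNetworks d := by
  convert relu_shallow_mem_deepNetworks (Submodule.smul_mem _ (-N)
    (Submodule.sum_mem _ fun j (_ : j ∈ Finset.univ) =>
      abs_coord_sub_mem_shallowNetworks j (c j))) 1 using 1
  ext x
  simp only [bump, Pi.smul_apply, Finset.sum_apply, smul_eq_mul, PiLp.sub_apply]
  ring_nf

lemma continuous_relu : Continuous relu := continuous_id.max continuous_const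

lemma relu_nonneg (t : ℝ) : 0 ≤ relu t := le_max_right _ _

lemma bump_nonneg {d : ℕ} (N : ℝ) (x : EuclideanSpace ℝ (Fin d)) : 0 ≤ bump N x := relu_nonneg _

lemma continuous_bump {d : ℕ} (N : ℝ) : Continuous (bump N : EuclideanSpace ℝ (Fin d) → ℝ) := by
  unfold bump
  exact continuous_relu.comp (by fun_prop)

lemma bump_zero {d : ℕ} (N : ℝ) : bump N (0 : EuclideanSpace ℝ (Fin d)) = 1 := by
  simp [bump, relu]

lemma norm_le_sum_abs {d : ℕ} (x : EuclideanSpace ℝ (Fin d)) : ‖x‖ ≤ ∑ j, |x j| := by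
  rw [EuclideanSpace.norm_eq]
  refine Real.sqrt_le_iff.2 ⟨Finset.sum_nonneg fun _ _ => abs_nonneg _, ?_⟩
  simpa using Finset.sum_sq_le_sq_sum_of_nonneg (s := Finset.univ) (f := fun j => |x j|)
    fun _ _ => abs_nonneg _

lemma bump_eq_zero {d : ℕ} {N : ℝ} (hN : 0 < N) {x : EuclideanSpace ℝ (Fin d)}
    (hx : N⁻¹ ≤ ‖x‖) : bump N x = 0 := by
  have h := hx.trans (norm_le_sum_abs x)
  rw [inv_le_iff_one_le_mul₀' hN] at h
  exact max_eq_right (by linarith)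

lemma bump_le_one {d : ℕ} {N : ℝ} (hN : 0 < N) (x : EuclideanSpace ℝ (Fin d)) : bump N x ≤ 1 :=
  max_le (by have := Finset.sum_nonneg fun j (_ : j ∈ Finset.univ) => abs_nonneg (x j); nlinarith)
    zero_le_one

lemma hasCompactSupport_bump {d : ℕ} {N : ℝ} (hN : 0 < N) :
    HasCompactSupport (bump N : EuclideanSpace ℝ (Fin d) → ℝ) :=
  HasCompactSupport.intro (isCompact_closedBall 0 N⁻¹) fun x hx =>
    bump_eq_zero hN (by simpa using (not_le.1 (by simpa using hx)).le)

open BoundedContinuousFunction in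
/-- The translate of a bump, as a bounded continuous function. -/
noncomputable def bumpAt {d : ℕ} {N : ℝ} (hN : 0 < N) (y : EuclideanSpace ℝ (Fin d)) :
    EuclideanSpace ℝ (Fin d) →ᵇ ℝ :=
  BoundedContinuousFunction.ofNormedAddCommGroup (fun x => bump N (x - y))
    ((continuous_bump N).comp (by fun_prop)) 1
    fun x => by rw [Real.norm_of_nonneg (bump_nonneg _ _)]; exact bump_le_one hN _

/-- Continuity in the sup norm is uniform continuity of the compactly supported bump. It makes the
convolution a Bochner integral. -/
lemma continuous_bumpAt {d : ℕ} {N : ℝ} (hN : 0 < N) :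
    Continuous (bumpAt hN : EuclideanSpace ℝ (Fin d) → _) := by
  have huc := Metric.uniformContinuous_iff.1
    ((hasCompactSupport_bump (d := d) hN).uniformContinuous_of_continuous (continuous_bump N))
  refine Metric.continuous_iff.2 fun y ε hε => ?_
  obtain ⟨δ, hδ, h⟩ := huc (ε / 2) (half_pos hε)
  refine ⟨δ, hδ, fun z hz => lt_of_le_of_lt ?_ (half_lt_self hε)⟩
  refine (BoundedContinuousFunction.dist_le (half_pos hε).le).2 fun x => (h ?_).le
  rwa [dist_sub_left]

/-- The quotient map by `W` commutes with the integral and kills the integrand. -/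
lemma integral_mem_of_isClosed {α F : Type*} [MeasurableSpace α] {μ : Measure α}
    [NormedAddCommGroup F] [NormedSpace ℝ F] [CompleteSpace F] {W : Submodule ℝ F}
    (hW : IsClosed (W : Set F)) {f : α → F} (hfi : Integrable f μ) (hf : ∀ x, f x ∈ W) :
    ∫ x, f x ∂μ ∈ W := by
  have : IsClosed (W : Set F) := hW
  rw [← Submodule.Quotient.mk_eq_zero W]
  have h := W.mkQL.integral_comp_comm hfi
  simp only [Submodule.mkQL_apply, Submodule.mkQ_apply,
    (Submodule.Quotient.mk_eq_zero W).2 (hf _), integral_zero] at h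
  exact h.symm

/-- Networks with two hidden layers are uniformly dense in `C_c(ℝ^d)`. -/
lemma exists_deepNetwork_near {d : ℕ} {g : EuclideanSpace ℝ (Fin d) → ℝ} (hg : Continuous g)
    (hgc : HasCompactSupport g) {η : ℝ} (hη : 0 < η) :
    ∃ f ∈ deepNetworks d, Continuous f ∧ ∀ x, |f x - g x| ≤ η := by
  -- The bump radius `δ` is a scale on which `g` varies by less than `η / 2`.
  obtain ⟨δ, hδ, huc⟩ := Metric.uniformContinuous_iff.1
    (hgc.uniformContinuous_of_continuous hg) (η / 2) (half_pos hη)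
  have hN : 0 < δ⁻¹ := inv_pos.2 hδ
  let V : Submodule ℝ (BoundedContinuousFunction (EuclideanSpace ℝ (Fin d)) ℝ) :=
    { carrier := {f | ⇑f ∈ deepNetworks d}
      zero_mem' := (deepNetworks d).zero_mem
      add_mem' := fun {_ _} hf hf' => (deepNetworks d).add_mem hf hf'
      smul_mem' := fun r _ hf => (deepNetworks d).smul_mem r hf }
  have hcont : Continuous fun y => g y • bumpAt hN y := hg.smul (continuous_bumpAt hN)
  have hint : Integrable fun y => g y • bumpAt hN y :=
    hcont.integrable_of_hasCompactSupport hgc.smul_right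
  have hmem : ∫ y, g y • bumpAt hN y ∈ V.topologicalClosure :=
    integral_mem_of_isClosed V.isClosed_topologicalClosure hint fun y =>
      V.le_topologicalClosure (V.smul_mem _ (bump_sub_mem_deepNetworks _ y))
  have heval (x) : (∫ y, g y • bumpAt hN y) x = ∫ y, g y * bump δ⁻¹ (x - y) :=
    ((BoundedContinuousFunction.evalCLM ℝ x).integral_comp_comm hint).symm
  have hbi : Integrable (bump δ⁻¹ : EuclideanSpace ℝ (Fin d) → ℝ) :=
    (continuous_bump _).integrable_of_hasCompactSupport (hasCompactSupport_bump hN)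
  have hc : 0 < ∫ z : EuclideanSpace ℝ (Fin d), bump δ⁻¹ z :=
    (continuous_bump _).integral_pos_of_hasCompactSupport_nonneg_nonzero
      (hasCompactSupport_bump hN) (bump_nonneg _) (x := 0) (by simp [bump_zero])
  set c := ∫ z : EuclideanSpace ℝ (Fin d), bump δ⁻¹ z with hcdef
  have hshift (x : EuclideanSpace ℝ (Fin d)) : ∫ y, bump δ⁻¹ (x - y) = c :=
    integral_sub_left_eq_self (bump δ⁻¹) volume x
  have happrox (x) : |(∫ y, g y • bumpAt hN y) x - c * g x| ≤ η / 2 * c := by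
    have hbx : Integrable fun y => bump δ⁻¹ (x - y) := hbi.comp_sub_left x
    have hgb : Integrable fun y => g y * bump δ⁻¹ (x - y) :=
      (hg.mul ((continuous_bump _).comp (by fun_prop))).integrable_of_hasCompactSupport
        hgc.mul_right
    rw [heval, ← hshift x, mul_comm _ (g x), ← integral_const_mul,
      ← integral_sub hgb (hbx.const_mul _), ← integral_const_mul]
    refine abs_integral_le_integral_abs.trans
      (integral_mono (hgb.sub (hbx.const_mul _)).abs (hbx.const_mul _) fun y => ?_)
    simp only
    rw [← sub_mul, abs_mul, abs_of_nonneg (bump_nonneg _ _)]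
    rcases lt_or_ge (dist y x) δ with h | h
    · have := (huc h).le
      rw [Real.dist_eq] at this
      exact mul_le_mul_of_nonneg_right this (bump_nonneg _ _)
    · rw [bump_eq_zero hN (by rwa [inv_inv, ← dist_eq_norm, dist_comm])]
      simp
  -- The bump has mass `c`, not 1, so errors carry a factor `c` until the final rescaling by `c⁻¹`.
  obtain ⟨f, hfV, hf⟩ := Metric.mem_closure_iff.1 hmem (η / 2 * c) (by positivity)
  refine ⟨c⁻¹ • ⇑f, Submodule.smul_mem _ _ hfV, f.continuous.const_smul _, fun x => ?_⟩
  have h1 := (BoundedContinuousFunction.dist_coe_le_dist (f := ∫ y, g y • bumpAt hN y) (g := f) x).trans hf.le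
  have h2 := happrox x
  rw [Real.dist_eq, abs_sub_comm] at h1
  have h3 : |f x - c * g x| ≤ c * η := by
    calc _ ≤ _ := abs_sub_le _ _ _
      _ ≤ η / 2 * c + η / 2 * c := add_le_add h1 h2
      _ = c * η := by ring
  have h4 : (c⁻¹ • ⇑f) x - g x = c⁻¹ * (f x - c * g x) := by
    simp only [Pi.smul_apply, smul_eq_mul]
    field_simp
  rw [h4, abs_mul, abs_of_pos (inv_pos.2 hc)]
  exact (inv_mul_le_iff₀ hc).2 h3

/-! ### Exponential moments of sub-Gaussian measures. -/

/-- A sub-Gaussian variable has exponential moments of all orders. -/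
lemma IsSubGaussianVar.integrable_exp_mul_abs {Ω : Type*} [MeasurableSpace Ω] {Z : Ω → ℝ}
    {μ : Measure Ω} [IsFiniteMeasure μ] (h : IsSubGaussianVar Z μ) (hZ : Measurable Z) {c : ℝ}
    (hc : 0 ≤ c) : Integrable (fun ω => Real.exp (c * |Z ω|)) μ := by
  obtain ⟨K, hK, h⟩ := h
  have hmeas : Measurable fun ω => Real.exp (c * |Z ω|) := by fun_prop
  refine ⟨hmeas.aestronglyMeasurable, ?_⟩
  rw [hasFiniteIntegral_iff_ofReal (ae_of_all _ fun _ => (Real.exp_pos _).le)]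
  let A (n : ℕ) : Set Ω := {ω | (n : ℝ) ≤ |Z ω|}
  have hA (n) : MeasurableSet (A n) := measurableSet_le measurable_const hZ.abs
  -- Completing the square gives `c (n + 1) - n² / K² ≤ c + K² (c + 1)² / 4 - n`, so the tail bound
  -- beats the exponential with a summable `exp (-n)` left over.
  set B := 2 * Real.exp (c + K ^ 2 * (c + 1) ^ 2 / 4) with hB
  calc ∫⁻ ω, ENNReal.ofReal (Real.exp (c * |Z ω|)) ∂μ
      ≤ ∫⁻ ω, ∑' n : ℕ, (A n).indicator
          (fun _ => ENNReal.ofReal (Real.exp (c * (n + 1)))) ω ∂μ := by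
        refine lintegral_mono fun ω => ?_
        refine le_trans ?_ (ENNReal.le_tsum ⌊|Z ω|⌋₊)
        rw [Set.indicator_of_mem (show ω ∈ A ⌊|Z ω|⌋₊ from Nat.floor_le (abs_nonneg (Z ω)))]
        refine ENNReal.ofReal_le_ofReal (Real.exp_le_exp.2 ?_)
        exact mul_le_mul_of_nonneg_left (Nat.lt_floor_add_one _).le hc
    _ = ∑' n : ℕ, ENNReal.ofReal (Real.exp (c * (n + 1))) * μ (A n) := by
        rw [lintegral_tsum fun n => (measurable_const.indicator (hA n)).aemeasurable]
        simp_rw [lintegral_indicator_const (hA _)]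
    _ ≤ ∑' n : ℕ, ENNReal.ofReal (B * Real.exp (-n)) := by
        refine ENNReal.tsum_le_tsum fun n => ?_
        rw [← ofReal_measureReal, ← ENNReal.ofReal_mul (Real.exp_pos _).le]
        refine ENNReal.ofReal_le_ofReal
          ((mul_le_mul_of_nonneg_left (h n n.cast_nonneg) (Real.exp_pos _).le).trans ?_)
        rw [hB, mul_left_comm, ← Real.exp_add, mul_assoc, ← Real.exp_add]
        refine mul_le_mul_of_nonneg_left (Real.exp_le_exp.2 ?_) zero_le_two
        have : 0 ≤ (n / K - K * (c + 1) / 2) ^ 2 := sq_nonneg _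
        have h2 : (n / K - K * (c + 1) / 2) ^ 2
            = n ^ 2 / K ^ 2 - n * (c + 1) + K ^ 2 * (c + 1) ^ 2 / 4 := by
          field_simp
          ring
        linarith
    _ < ∞ := by
        rw [← ENNReal.ofReal_tsum_of_nonneg (fun n => by positivity)
          (Real.summable_exp_neg_nat.mul_left B)]
        exact ENNReal.ofReal_lt_top

/-- Since `‖x‖ ≤ d * max |x j|`, the exponential is dominated by a sum over coordinates. -/
lemma IsSubGaussianMeasure.integrable_exp_mul_norm {d : ℕ}
    {Q : Measure (EuclideanSpace ℝ (Fin d))} [IsFiniteMeasure Q] (hQ : IsSubGaussianMeasure Q)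
    {c : ℝ} (hc : 0 ≤ c) : Integrable (fun x => Real.exp (c * ‖x‖)) Q := by
  have hcoord (j : Fin d) : Integrable (fun x => Real.exp (c * d * |x j|)) Q := by
    have h := hQ (EuclideanSpace.single j 1) (by simp)
    simp only [EuclideanSpace.inner_single_left, map_one, one_mul] at h
    exact h.integrable_exp_mul_abs (by fun_prop) (by positivity)
  -- The constant 1 covers `d = 0`, where the sum is empty.
  refine ((integrable_const (1 : ℝ)).add
    (integrable_finsetSum Finset.univ fun j _ => hcoord j)).mono'
    (by fun_prop) (ae_of_all _ fun x => ?_)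
  rw [Real.norm_of_nonneg (Real.exp_pos _).le, Pi.add_apply]
  rcases isEmpty_or_nonempty (Fin d) with hd | hd
  · simp [Subsingleton.elim x 0]
  · obtain ⟨j, -, hj⟩ := Finset.exists_max_image Finset.univ (fun j => |x j|) Finset.univ_nonempty
    have h1 : ‖x‖ ≤ d * |x j| := (norm_le_sum_abs x).trans
      ((Finset.sum_le_card_nsmul _ _ _ hj).trans (by simp))
    have h2 : Real.exp (c * ‖x‖) ≤ Real.exp (c * d * |x j|) :=
      Real.exp_le_exp.2 (by rw [mul_assoc]; exact mul_le_mul_of_nonneg_left h1 hc)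
    have h3 := Finset.single_le_sum (f := fun j => Real.exp (c * d * |x j|))
      (fun i _ => (Real.exp_pos _).le) (Finset.mem_univ j)
    simp only at h3
    linarith

/-! ### The Donsker-Varadhan formula and its near-maximisers. -/

/-- The upper bound in the Donsker-Varadhan formula. -/
lemma integral_sub_log_integral_exp_le_klDiv {α : Type*} [MeasurableSpace α] {P Q : Measure α}
    [IsProbabilityMeasure P] [IsProbabilityMeasure Q] (hR : InformationTheory.klDiv P Q ≠ ∞)
    {f : α → ℝ} (hfP : Integrable f P) (hfQ : Integrable (fun x => Real.exp (f x)) Q) :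
    ∫ x, f x ∂P - Real.log (∫ x, Real.exp (f x) ∂Q) ≤ (InformationTheory.klDiv P Q).toReal := by
  obtain ⟨hPQ, hint⟩ := InformationTheory.klDiv_ne_top_iff.1 hR
  have : IsProbabilityMeasure (Q.tilted f) := isProbabilityMeasure_tilted hfQ
  -- Gibbs' inequality for `P` against the tilted measure.
  have h1 := InformationTheory.integral_llr_add_sub_measure_univ_nonneg
    (hPQ.trans (absolutelyContinuous_tilted hfQ)) (integrable_llr_tilted_right hPQ hfP hint hfQ)
  rw [integral_llr_tilted_right hPQ hfP hfQ hint] at h1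
  rw [InformationTheory.toReal_klDiv_of_measure_eq hPQ (by simp)]
  simp only [probReal_univ] at h1
  linarith

/-- A bounded measurable function nearly attains the supremum in the (linearized)
Donsker-Varadhan formula. -/
lemma exists_bounded_klDiv_sub_lt {α : Type*} [MeasurableSpace α] {P Q : Measure α}
    [IsProbabilityMeasure P] [IsProbabilityMeasure Q] (hR : InformationTheory.klDiv P Q ≠ ∞)
    {ε : ℝ} (hε : 0 < ε) :
    ∃ (f : α → ℝ) (M : ℝ), Measurable f ∧ (∀ x, |f x| ≤ M) ∧
      (InformationTheory.klDiv P Q).toReal - ε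
        < ∫ x, f x ∂P - ∫ x, Real.exp (f x) ∂Q + 1 := by
  obtain ⟨hPQ, hint⟩ := InformationTheory.klDiv_ne_top_iff.1 hR
  rw [InformationTheory.toReal_klDiv_of_measure_eq hPQ (by simp)]
  set p : α → ℝ := fun x => (P.rnDeriv Q x).toReal with hp
  have hpm : Measurable p := (Measure.measurable_rnDeriv P Q).ennreal_toReal
  have hpi : Integrable p Q := Measure.integrable_toReal_rnDeriv
  have hp1 : ∫ x, p x ∂Q = 1 := by
    rw [hp, Measure.integral_toReal_rnDeriv hPQ]
    simp
  have hp0 (x) : 0 ≤ p x := ENNReal.toReal_nonneg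
  have hpP : ∀ᵐ x ∂P, 0 < p x := by
    filter_upwards [Measure.rnDeriv_pos hPQ, hPQ.ae_le (Measure.rnDeriv_lt_top P Q)] with x h1 h2
    exact ENNReal.toReal_pos h1.ne' h2.ne
  -- The density clipped to `[1 / (n + 1), n + 1]`, so that its logarithm is bounded.
  let q (n : ℕ) (x : α) : ℝ := max (1 / ((n : ℝ) + 1)) (min (p x) (n + 1))
  have hqm (n) : Measurable (q n) := by fun_prop
  have hqpos (n : ℕ) (x) : 1 / ((n : ℝ) + 1) ≤ q n x := le_max_left _ _
  have hqpos' (n x) : 0 < q n x := lt_of_lt_of_le (by positivity) (hqpos n x)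
  have hn1 (n : ℕ) : 1 / ((n : ℝ) + 1) ≤ 1 := by
    rw [div_le_one (by positivity)]
    linarith [n.cast_nonneg (α := ℝ)]
  have hqle (n : ℕ) (x) : q n x ≤ n + 1 :=
    max_le ((hn1 n).trans (by linarith [n.cast_nonneg (α := ℝ)])) (min_le_right _ _)
  have hlim (x : α) : Tendsto (fun n => q n x) atTop (nhds (p x)) := by
    have h1 : Tendsto (fun n : ℕ => 1 / ((n : ℝ) + 1)) atTop (nhds 0) :=
      tendsto_one_div_add_atTop_nhds_zero_nat
    have h2 : Tendsto (fun n : ℕ => min (p x) ((n : ℝ) + 1)) atTop (nhds (p x)) := by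
      refine tendsto_const_nhds.congr' ?_
      filter_upwards [eventually_ge_atTop ⌈p x⌉₊] with n hn
      rw [min_eq_left]
      have := Nat.ceil_le.1 hn
      linarith
    have := h1.max h2
    rwa [max_eq_right (hp0 x)] at this
  -- The clipping interval contains 1, so clipping moves `p` towards 1 and shrinks `|log p|`; thus
  -- `|llr P Q|` dominates.
  have hlimP : Tendsto (fun n => ∫ x, Real.log (q n x) ∂P) atTop (nhds (∫ x, llr P Q x ∂P)) := by
    refine tendsto_integral_of_dominated_convergence (fun x => |llr P Q x|)
      (fun n => (hqm n).log.aestronglyMeasurable) hint.abs (fun n => ?_) ?_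
    · filter_upwards [hpP] with x hx
      rw [Real.norm_eq_abs, llr_def]
      change |Real.log (q n x)| ≤ |Real.log (p x)|
      rcases le_total 1 (p x) with h | h
      · have h1 : 1 ≤ q n x :=
          le_max_of_le_right (le_min h (by linarith [n.cast_nonneg (α := ℝ)]))
        have h2 : q n x ≤ p x := max_le ((hn1 n).trans h) (min_le_left _ _)
        rw [abs_of_nonneg (Real.log_nonneg h1), abs_of_nonneg (Real.log_nonneg h)]
        exact Real.log_le_log (hqpos' n x) h2
      · have h1 : q n x ≤ 1 := max_le (hn1 n) ((min_le_left _ _).trans h)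
        have h2 : p x ≤ q n x :=
          le_max_of_le_right (le_min le_rfl (by linarith [n.cast_nonneg (α := ℝ)]))
        rw [abs_of_nonpos (Real.log_nonpos (hqpos' n x).le h1),
          abs_of_nonpos (Real.log_nonpos (hp0 x) h)]
        exact neg_le_neg (Real.log_le_log hx h2)
    · filter_upwards [hpP] with x hx
      exact (hlim x).log hx.ne'
  have hlimQ : Tendsto (fun n => ∫ x, q n x ∂Q) atTop (nhds 1) := by
    rw [← hp1]
    refine tendsto_integral_of_dominated_convergence (fun x => 1 + p x)
      (fun n => (hqm n).aestronglyMeasurable) ((integrable_const _).add hpi)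
      (fun n => ae_of_all _ fun x => ?_) (ae_of_all _ fun x => hlim x)
    rw [Real.norm_of_nonneg (hqpos' n x).le]
    exact max_le ((hn1 n).trans (by linarith [hp0 x])) ((min_le_left _ _).trans (by linarith))
  have hJ := (hlimP.sub hlimQ).add_const 1
  rw [sub_add_cancel] at hJ
  obtain ⟨n, hn⟩ := (hJ.eventually (lt_mem_nhds (sub_lt_self _ hε))).exists
  refine ⟨fun x => Real.log (q n x), Real.log (n + 1), (hqm n).log, fun x => ?_, ?_⟩
  · rw [abs_le, ← Real.log_inv, ← one_div]
    exact ⟨Real.log_le_log (by positivity) (hqpos n x), Real.log_le_log (hqpos' n x) (hqle n x)⟩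
  · simpa only [Real.exp_log (hqpos' n _)] using hn

/-- The graph of `exp` lies above its tangent at `a`; only `a` needs an upper bound. -/
lemma exp_sub_exp_le_mul {a b M : ℝ} (ha : a ≤ M) : Real.exp a - Real.exp b ≤ Real.exp M * |a - b| := by
  have h1 : Real.exp b = Real.exp a * Real.exp (b - a) := by rw [← Real.exp_add]; ring_nf
  have h2 := Real.add_one_le_exp (b - a)
  have h3 := Real.exp_pos a
  have h4 : Real.exp a ≤ Real.exp M := Real.exp_le_exp.2 ha
  have h5 := le_abs_self (a - b)
  calc Real.exp a - Real.exp b ≤ Real.exp a * (a - b) := by rw [h1]; nlinarith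
    _ ≤ Real.exp a * |a - b| := mul_le_mul_of_nonneg_left h5 h3.le
    _ ≤ _ := mul_le_mul_of_nonneg_right h4 (abs_nonneg _)

/-- Clipping an `L¹` approximant to `[-M, M]` is 1-Lipschitz and fixes `f` and 0, so neither the
error nor the support grows. -/
lemma exists_continuous_bounded_near {α : Type*} [TopologicalSpace α] [T2Space α]
    [WeaklyLocallyCompactSpace α] [NormalSpace α]
    [MeasurableSpace α] [BorelSpace α] {μ : Measure α} [μ.Regular] [IsFiniteMeasure μ] {f : α → ℝ}
    (hf : Measurable f) {M : ℝ} (hM : ∀ x, |f x| ≤ M) {η : ℝ} (hη : 0 < η) :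
    ∃ g : α → ℝ, Continuous g ∧ HasCompactSupport g ∧ (∀ x, |g x| ≤ M) ∧
      ∫ x, |f x - g x| ∂μ ≤ η := by
  have hfi : Integrable f μ := .of_bound hf.aestronglyMeasurable M (ae_of_all _ hM)
  obtain ⟨g, hgc, hfg, hg, hgi⟩ := hfi.exists_hasCompactSupport_integral_sub_le hη
  rcases isEmpty_or_nonempty α with h | ⟨⟨x₀⟩⟩
  · exact ⟨g, hg, hgc, fun x => h.elim x, by simpa using hfg⟩
  have hM0 : 0 ≤ M := (abs_nonneg _).trans (hM x₀)
  have hcont : Continuous fun x => max (-M) (min (g x) M) := by fun_prop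
  have hbd (x) : |max (-M) (min (g x) M)| ≤ M :=
    abs_le.2 ⟨le_max_left _ _, max_le (by linarith) (min_le_right _ _)⟩
  refine ⟨fun x => max (-M) (min (g x) M), hcont, ?_, hbd, le_trans ?_ hfg⟩
  · exact hgc.comp_left (g := fun t => max (-M) (min t M)) (by simp [hM0])
  · refine integral_mono ?_ (hfi.sub hgi).norm fun x => ?_
    · exact (hfi.sub (.of_bound hcont.aestronglyMeasurable M (ae_of_all _ hbd))).abs
    · have h1 : f x = max (-M) (min (f x) M) := by
        rw [min_eq_left (abs_le.1 (hM x)).2, max_eq_right (abs_le.1 (hM x)).1]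
      calc |f x - max (-M) (min (g x) M)|
          = |max (-M) (min (f x) M) - max (-M) (min (g x) M)| := by rw [← h1]
        _ ≤ |min (f x) M - min (g x) M| := by
          simpa using abs_max_sub_max_le_max (-M) (min (f x) M) (-M) (min (g x) M) 
        _ ≤ ‖f x - g x‖ := by simpa using abs_min_sub_min_le_max (f x) M (g x) M

/-- Networks with two hidden layers nearly attain the supremum in the Donsker-Varadhan formula. -/
lemma exists_deepNetwork_klDiv_sub_lt {d : ℕ} {P Q : Measure (EuclideanSpace ℝ (Fin d))}
    [IsProbabilityMeasure P] [IsProbabilityMeasure Q] (hR : InformationTheory.klDiv P Q ≠ ∞)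
    {ε : ℝ} (hε : 0 < ε) :
    ∃ f ∈ deepNetworks d, (InformationTheory.klDiv P Q).toReal - ε
      < ∫ x, f x ∂P - Real.log (∫ x, Real.exp (f x) ∂Q) := by
  obtain ⟨T, M, hT, hM, hTε⟩ := exists_bounded_klDiv_sub_lt hR (half_pos hε)
  -- Replacing `T` by `f` costs at most `2 η` in the `P`-integral and `2 η exp (M + 1)` in the
  -- `Q`-integral; `η ≤ 1` ensures `|f| ≤ M + 1`.
  set C := 2 + 2 * Real.exp (M + 1) with hC
  have hCpos : 0 < C := by positivity
  set η := min 1 (ε / (2 * C)) with hη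
  have hη0 : 0 < η := by positivity
  have hηC : C * η ≤ ε / 2 := by
    have := mul_le_mul_of_nonneg_left (min_le_right 1 (ε / (2 * C))) hCpos.le
    rwa [← hη, show C * (ε / (2 * C)) = ε / 2 by field_simp] at this
  obtain ⟨g, hg, hgc, hgM, hTg⟩ := exists_continuous_bounded_near (μ := P + Q) hT hM hη0
  obtain ⟨f, hf, hfc, hfg⟩ := exists_deepNetwork_near hg hgc hη0
  refine ⟨f, hf, ?_⟩
  have hfM (x) : |f x| ≤ M + 1 := by
    have h1 := abs_sub_abs_le_abs_sub (f x) (g x)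
    have h2 := hfg x
    have h3 := hgM x
    have h4 : η ≤ 1 := min_le_left _ _
    linarith
  have hfi (μ : Measure (EuclideanSpace ℝ (Fin d))) [IsFiniteMeasure μ] : Integrable f μ :=
    .of_bound hfc.aestronglyMeasurable (M + 1) (ae_of_all _ hfM)
  have hgi (μ : Measure (EuclideanSpace ℝ (Fin d))) [IsFiniteMeasure μ] : Integrable g μ :=
    .of_bound hg.aestronglyMeasurable M (ae_of_all _ hgM)
  have hTi (μ : Measure (EuclideanSpace ℝ (Fin d))) [IsFiniteMeasure μ] : Integrable T μ :=
    .of_bound hT.aestronglyMeasurable M (ae_of_all _ hM)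
  have hexp {u : EuclideanSpace ℝ (Fin d) → ℝ} {K : ℝ} (hu : Measurable u)
      (huK : ∀ x, |u x| ≤ K) : Integrable (fun x => Real.exp (u x)) Q := by
    refine .of_bound hu.exp.aestronglyMeasurable (Real.exp K) (ae_of_all _ fun x => ?_)
    rw [Real.norm_of_nonneg (Real.exp_pos _).le]
    exact Real.exp_le_exp.2 (abs_le.1 (huK x)).2
  rw [integral_add_measure (f := fun x => |T x - g x|) ((hTi P).sub (hgi P)).abs
    ((hTi Q).sub (hgi Q)).abs] at hTg
  have hP0 : 0 ≤ ∫ x, |T x - g x| ∂P := integral_nonneg fun _ => abs_nonneg _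
  have hQ0 : 0 ≤ ∫ x, |T x - g x| ∂Q := integral_nonneg fun _ => abs_nonneg _
  have hdiff (μ : Measure (EuclideanSpace ℝ (Fin d))) [IsProbabilityMeasure μ] :
      ∫ x, |f x - T x| ∂μ ≤ η + ∫ x, |T x - g x| ∂μ := by
    calc ∫ x, |f x - T x| ∂μ ≤ ∫ x, (η + |T x - g x|) ∂μ := by
          refine integral_mono ((hfi μ).sub (hTi μ)).abs
            ((integrable_const _).add ((hTi μ).sub (hgi μ)).abs) fun x => ?_
          have h1 := abs_sub_le (f x) (g x) (T x)
          have h2 := hfg x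
          rw [abs_sub_comm (g x)] at h1
          simp only
          linarith
      _ = _ := by
          rw [integral_add (g := fun x => |T x - g x|) (integrable_const _)
            ((hTi μ).sub (hgi μ)).abs]
          simp
  have h1 : ∫ x, T x ∂P - ∫ x, f x ∂P ≤ 2 * η := by
    rw [← integral_sub (hTi P) (hfi P)]
    refine ((le_abs_self _).trans abs_integral_le_integral_abs).trans ?_
    simp_rw [abs_sub_comm (T _)]
    linarith [hdiff P]
  have h2 : ∫ x, Real.exp (f x) ∂Q - ∫ x, Real.exp (T x) ∂Q ≤ Real.exp (M + 1) * (2 * η) := by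
    rw [← integral_sub (hexp hfc.measurable hfM) (hexp hT hM)]
    calc ∫ x, (Real.exp (f x) - Real.exp (T x)) ∂Q
        ≤ ∫ x, Real.exp (M + 1) * |f x - T x| ∂Q :=
          integral_mono ((hexp hfc.measurable hfM).sub (hexp hT hM))
            (((hfi Q).sub (hTi Q)).abs.const_mul _)
            fun x => exp_sub_exp_le_mul (abs_le.1 (hfM x)).2
      _ = Real.exp (M + 1) * ∫ x, |f x - T x| ∂Q := integral_const_mul _ _
      _ ≤ _ := mul_le_mul_of_nonneg_left (by linarith [hdiff Q]) (Real.exp_pos _).le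
  -- `log t ≤ t - 1` returns from the linearized functional to the original one.
  have h3 := Real.log_le_sub_one_of_pos (integral_exp_pos (hexp hfc.measurable hfM))
  rw [hC] at hηC
  linarith

/-! ### Networks as random elements of `C(Θ, ℝ)`. -/

lemma continuous_network {d l₁ l₂ : ℕ} :
    Continuous fun p : EuclideanSpace ℝ (Fin d) × ParamSpace d l₁ l₂ => network p.2 p.1 := by
  unfold network hidden₂ hidden₁ relu
  fun_prop

lemma abs_relu_le (t : ℝ) : |relu t| ≤ |t| := by
  rw [abs_of_nonneg (relu_nonneg t)]
  exact max_le (le_abs_self t) (abs_nonneg t)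

/-- Propagates a linear growth bound through one layer, with `r = 1 + ‖x‖`. -/
lemma abs_sum_mul_add_le {ι : Type*} [Fintype ι] (a y z : ι → ℝ) (b r : ℝ) (hr : 1 ≤ r)
    (hy : ∀ i, |y i| ≤ z i * r) : |∑ i, a i * y i + b| ≤ (∑ i, |a i| * z i + |b|) * r := by
  rw [add_mul, Finset.sum_mul]
  refine (abs_add_le _ _).trans (add_le_add ?_ (le_mul_of_one_le_right (abs_nonneg b) hr))
  refine (Finset.abs_sum_le_sum_abs _ _).trans (Finset.sum_le_sum fun i _ => ?_)
  rw [abs_mul, mul_assoc]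
  exact mul_le_mul_of_nonneg_left (hy i) (abs_nonneg _)

lemma exists_continuous_abs_network_le (d l₁ l₂ : ℕ) :
    ∃ C : ParamSpace d l₁ l₂ → ℝ, Continuous C ∧
      ∀ θ x, |network θ x| ≤ C θ * (1 + ‖x‖) := by
  refine ⟨fun θ => ∑ k, |θ (.weightOut k)| * (∑ i, |θ (.weight₂ k i)| *
    (∑ j, |θ (.weight₁ i j)| * 1 + |θ (.bias₁ i)|) + |θ (.bias₂ k)|) + |θ .biasOut|,
    by fun_prop, fun θ x => ?_⟩
  have hr : 1 ≤ 1 + ‖x‖ := le_add_of_nonneg_right (norm_nonneg x)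
  refine abs_sum_mul_add_le _ _ _ _ _ hr fun k => (abs_relu_le _).trans ?_
  refine abs_sum_mul_add_le _ _ _ _ _ hr fun i => (abs_relu_le _).trans ?_
  refine abs_sum_mul_add_le _ _ _ _ _ hr fun j => ?_
  have := PiLp.norm_apply_le x j
  rw [Real.norm_eq_abs] at this
  linarith

/-- The map sending a point `x` to the function `θ ↦ T_θ(x)` on `Θ`. -/
def networkEval {d l₁ l₂ : ℕ} (Θ : Set (ParamSpace d l₁ l₂)) :
    C(EuclideanSpace ℝ (Fin d), C(Θ, ℝ)) :=
  ContinuousMap.curry ⟨fun p => network p.2.1 p.1,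
    continuous_network.comp (continuous_fst.prodMk (continuous_subtype_val.comp continuous_snd))⟩

lemma networkEval_apply {d l₁ l₂ : ℕ} (Θ : Set (ParamSpace d l₁ l₂))
    (x : EuclideanSpace ℝ (Fin d)) (θ : Θ) : networkEval Θ x θ = network θ.1 x := rfl

/-- The map sending a point `x` to the function `θ ↦ exp (T_θ(x))` on `Θ`. -/
noncomputable def expNetworkEval {d l₁ l₂ : ℕ} (Θ : Set (ParamSpace d l₁ l₂)) :
    C(EuclideanSpace ℝ (Fin d), C(Θ, ℝ)) :=
  ContinuousMap.curry ⟨fun p => Real.exp (network p.2.1 p.1),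
    (continuous_network.comp
      (continuous_fst.prodMk (continuous_subtype_val.comp continuous_snd))).rexp⟩

lemma expNetworkEval_apply {d l₁ l₂ : ℕ} (Θ : Set (ParamSpace d l₁ l₂))
    (x : EuclideanSpace ℝ (Fin d)) (θ : Θ) :
    expNetworkEval Θ x θ = Real.exp (network θ.1 x) := rfl

lemma exists_abs_network_le_of_isCompact {d l₁ l₂ : ℕ} {Θ : Set (ParamSpace d l₁ l₂)}
    (hΘ : IsCompact Θ) :
    ∃ B : ℝ, 0 ≤ B ∧ ∀ θ ∈ Θ, ∀ x, |network θ x| ≤ B * (1 + ‖x‖) := by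
  obtain ⟨C, hC, hb⟩ := exists_continuous_abs_network_le d l₁ l₂
  obtain ⟨B, hB⟩ := hΘ.exists_bound_of_continuousOn hC.continuousOn
  refine ⟨max B 0, le_max_right _ _, fun θ hθ x => (hb θ x).trans
    (mul_le_mul_of_nonneg_right ?_ (by positivity))⟩
  exact (le_abs_self _).trans ((hB θ hθ).trans (le_max_left _ _))

/-- The norm in `C(Θ, ℝ)` is a supremum over `Θ`, so a linear envelope uniform in `θ` suffices. -/
lemma integrable_networkEval {d l₁ l₂ : ℕ} {Θ : Set (ParamSpace d l₁ l₂)} [CompactSpace Θ]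
    {P : Measure (EuclideanSpace ℝ (Fin d))} [IsFiniteMeasure P]
    (hP : Integrable (fun x => ‖x‖) P) : Integrable (networkEval Θ) P := by
  obtain ⟨B, hB0, hB⟩ := exists_abs_network_le_of_isCompact (isCompact_iff_compactSpace.2 ‹_›)
  refine (((integrable_const (1 : ℝ)).add hP).const_mul B).mono'
    (networkEval Θ).continuous.aestronglyMeasurable (ae_of_all _ fun x => ?_)
  exact (ContinuousMap.norm_le _ (by simp only [Pi.add_apply]; positivity)).2
    fun θ => hB θ.1 θ.2 x

lemma integrable_expNetworkEval {d l₁ l₂ : ℕ} {Θ : Set (ParamSpace d l₁ l₂)} [CompactSpace Θ]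
    {Q : Measure (EuclideanSpace ℝ (Fin d))} [IsFiniteMeasure Q]
    (hQ : IsSubGaussianMeasure Q) : Integrable (expNetworkEval Θ) Q := by
  obtain ⟨B, hB0, hB⟩ := exists_abs_network_le_of_isCompact (isCompact_iff_compactSpace.2 ‹_›)
  refine ((hQ.integrable_exp_mul_norm hB0).const_mul (Real.exp B)).mono'
    (expNetworkEval Θ).continuous.aestronglyMeasurable (ae_of_all _ fun x => ?_)
  refine (ContinuousMap.norm_le _ (by positivity)).2 fun θ => ?_
  rw [expNetworkEval_apply, Real.norm_of_nonneg (Real.exp_pos _).le, ← Real.exp_add]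
  refine Real.exp_le_exp.2 ((le_abs_self _).trans ((hB θ.1 θ.2 x).trans_eq ?_))
  ring

/-! ### Uniform law of large numbers and convergence of the estimate. -/

/-- The strong law of large numbers for a continuous Banach space valued function of i.i.d.
samples. -/
lemma strong_law_ae_comp {E F Ω : Type*} [TopologicalSpace E] [SecondCountableTopology E]
    [MeasurableSpace E] [BorelSpace E] [NormedAddCommGroup F] [NormedSpace ℝ F] [CompleteSpace F]
    [MeasurableSpace Ω] {μ : Measure Ω} {P : Measure E} {X : ℕ → Ω → E}
    (hX : ∀ i, HasLaw (X i) P μ) (hind : iIndepFun X μ) {f : E → F} (hf : Continuous f)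
    (hfi : Integrable f P) :
    ∀ᵐ ω ∂μ, Tendsto (fun n : ℕ => (n : ℝ)⁻¹ • ∑ i ∈ Finset.range n, f (X i ω)) atTop
      (nhds (∫ x, f x ∂P)) := by
  borelize F
  have h0 : Integrable (fun ω => f (X 0 ω)) μ := by
    have := (hX 0).map_eq ▸ hfi
    exact this.comp_aemeasurable (hX 0).aemeasurable
  have h1 : ∫ ω, f (X 0 ω) ∂μ = ∫ x, f x ∂P := by
    rw [← (hX 0).map_eq, integral_map (hX 0).aemeasurable]
    exact hf.aestronglyMeasurable
  rw [← h1]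
  exact strong_law_ae (fun i ω => f (X i ω)) h0
    (fun i j hij => (hind.indepFun hij).comp hf.measurable hf.measurable)
    fun i => ((hX i).identDistrib (hX 0)).comp hf.measurable

lemma EReal.abs_coe_sub_le {r c : ℝ} {s : EReal} (h1 : ((r - c : ℝ) : EReal) ≤ s)
    (h2 : s ≤ ((r + c : ℝ) : EReal)) : ((r : EReal) - s).abs ≤ ENNReal.ofReal c := by
  induction s with
  | bot => exact absurd h1 (not_le.2 (EReal.bot_lt_coe _))
  | top => exact absurd h2 (not_le.2 (EReal.coe_lt_top _))
  | coe s =>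
    rw [EReal.coe_le_coe_iff] at h1 h2
    rw [← EReal.coe_sub, EReal.abs_def]
    exact ENNReal.ofReal_le_ofReal (abs_le.2 ⟨by linarith, by linarith⟩)

/-- By compactness `b₀` has a positive minimum, so uniform closeness of `b i` to `b₀` gives `b i ≥
exp (-η) * b₀`. This side is all that the upper bound on the estimate needs. -/
lemma eventually_forall_sub_log_le {K ι : Type*} [TopologicalSpace K] [CompactSpace K] [Nonempty K]
    {l : Filter ι} {b : ι → C(K, ℝ)} {b₀ : C(K, ℝ)} (hb : Tendsto b l (nhds b₀))
    (hpos : ∀ θ, 0 < b₀ θ) {η : ℝ} (hη : 0 < η) :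
    ∀ᶠ i in l, ∀ θ, Real.log (b₀ θ) - η ≤ Real.log (b i θ) := by
  obtain ⟨θ₀, -, hθ₀⟩ := isCompact_univ.exists_isMinOn Set.univ_nonempty b₀.continuous.continuousOn
  have hexp : 0 < 1 - Real.exp (-η) := by
    have := Real.exp_lt_exp.2 (neg_lt_zero.2 hη)
    rw [Real.exp_zero] at this
    linarith
  filter_upwards [Metric.tendsto_nhds.1 hb _ (mul_pos (hpos θ₀) hexp)] with i hi θ
  have h1 : |b i θ - b₀ θ| < b₀ θ₀ * (1 - Real.exp (-η)) :=
    (ContinuousMap.dist_apply_le_dist (f := b i) (g := b₀) θ).trans_lt hi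
  have h2 : b₀ θ₀ * (1 - Real.exp (-η)) ≤ b₀ θ * (1 - Real.exp (-η)) :=
    mul_le_mul_of_nonneg_right (hθ₀ (Set.mem_univ θ)) hexp.le
  have h3 : b₀ θ * Real.exp (-η) ≤ b i θ := by
    have := (abs_lt.1 h1).1
    linarith
  calc Real.log (b₀ θ) - η = Real.log (b₀ θ * Real.exp (-η)) := by
        rw [Real.log_mul (hpos θ).ne' (Real.exp_pos _).ne', Real.log_exp, sub_eq_add_neg]
    _ ≤ _ := Real.log_le_log (mul_pos (hpos θ) (Real.exp_pos _)) h3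

/-- Uniform convergence of the empirical means implies convergence of the empirical
Donsker-Varadhan estimate, up to the approximation error `ε`. -/
lemma limsup_abs_klDiv_sub_empiricalDV_lt {d l₁ l₂ : ℕ} {Θ : Set (ParamSpace d l₁ l₂)}
    [CompactSpace Θ] {x y : ℕ → EuclideanSpace ℝ (Fin d)} {a b : C(Θ, ℝ)} {R ε : ℝ}
    (hε : 0 < ε)
    (ha : Tendsto (fun n : ℕ => (n : ℝ)⁻¹ • ∑ i ∈ Finset.range n, networkEval Θ (x i)) atTop (nhds a))
    (hb : Tendsto (fun m : ℕ => (m : ℝ)⁻¹ • ∑ j ∈ Finset.range m, expNetworkEval Θ (y j)) atTop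
      (nhds b))
    (hpos : ∀ θ, 0 < b θ) (hle : ∀ θ, a θ - Real.log (b θ) ≤ R) (θ₀ : Θ)
    (hθ₀ : R - ε / 2 < a θ₀ - Real.log (b θ₀)) :
    limsup (fun p : ℕ × ℕ => ((R : EReal) - empiricalDV x y p.1 p.2 (networkClass Θ)).abs)
      (atTop ×ˢ atTop) < ENNReal.ofReal ε := by
  have : Nonempty Θ := ⟨θ₀⟩
  have hmean (n : ℕ) (θ : Θ) : empiricalMean x n (network θ.1)
      = ((n : ℝ)⁻¹ • ∑ i ∈ Finset.range n, networkEval Θ (x i)) θ := by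
    simp [empiricalMean, networkEval_apply, div_eq_inv_mul]
  have hmean' (m : ℕ) (θ : Θ) : empiricalMean y m (fun z => Real.exp (network θ.1 z))
      = ((m : ℝ)⁻¹ • ∑ j ∈ Finset.range m, expNetworkEval Θ (y j)) θ := by
    simp [empiricalMean, expNetworkEval_apply, div_eq_inv_mul]
  -- The lower bound needs convergence at `θ₀` only; the upper bound below needs it uniformly in
  -- `θ`.
  have hlower : ∀ᶠ p : ℕ × ℕ in atTop ×ˢ atTop, R - ε / 2 <
      empiricalMean x p.1 (network θ₀.1)
        - Real.log (empiricalMean y p.2 fun z => Real.exp (network θ₀.1 z)) := by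
    simp only [hmean, hmean']
    have ha' := ((continuous_eval_const θ₀).tendsto a).comp ha
    have hb' := (((continuous_eval_const θ₀).tendsto b).comp hb).log (hpos θ₀).ne'
    exact ((ha'.comp tendsto_fst).sub (hb'.comp tendsto_snd)).eventually (lt_mem_nhds hθ₀)
  have hupper : ∀ᶠ p : ℕ × ℕ in atTop ×ˢ atTop, ∀ θ : Θ,
      empiricalMean x p.1 (network θ.1)
        - Real.log (empiricalMean y p.2 fun z => Real.exp (network θ.1 z)) ≤ R + ε / 2 := by
    simp only [hmean, hmean']
    have h4 : 0 < ε / 4 := by positivity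
    filter_upwards [tendsto_fst.eventually (Metric.tendsto_nhds.1 ha _ h4),
      tendsto_snd.eventually (eventually_forall_sub_log_le hb hpos h4)] with p h1 h2 θ
    have h3 := (le_abs_self _).trans
      ((ContinuousMap.dist_apply_le_dist θ).trans h1.le)
    linarith [h2 θ, hle θ]
  -- The error is eventually at most `ε / 2`, which leaves room for the strict inequality.
  refine lt_of_le_of_lt (limsup_le_of_le (by isBoundedDefault) (a := ENNReal.ofReal (ε / 2)) ?_)
    ((ENNReal.ofReal_lt_ofReal_iff hε).2 (half_lt_self hε))
  filter_upwards [hlower, hupper] with p h1 h2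
  refine EReal.abs_coe_sub_le ?_ ?_
  · exact (EReal.coe_le_coe_iff.2 h1.le).trans
      (le_iSup₂_of_le (network θ₀.1) ⟨θ₀.1, θ₀.2, rfl⟩ le_rfl)
  · refine iSup₂_le ?_
    rintro _ ⟨θ, hθ, rfl⟩
    exact EReal.coe_le_coe_iff.2 (h2 ⟨θ, hθ⟩)

theorem mainTheorem1 {d : ℕ} (P Q : Measure (EuclideanSpace ℝ (Fin d)))
    [IsProbabilityMeasure P] [IsProbabilityMeasure Q]
    (hPQ : P ≪ Q) (hR : InformationTheory.klDiv P Q < ∞)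
    (hP₁ : Integrable (fun x => ‖x‖) P) (hQ₁ : Integrable (fun x => ‖x‖) Q)
    (hQ : IsSubGaussianMeasure Q) (ε : ℝ) (hε : 0 < ε) :
    ∃ L₁ L₂ : ℕ, ∀ l₁ l₂ : ℕ, L₁ ≤ l₁ → L₂ ≤ l₂ →
      ∃ Θ₀ : Set (ParamSpace d l₁ l₂), Θ₀.Nonempty ∧ IsCompact Θ₀ ∧
        ∀ Θ : Set (ParamSpace d l₁ l₂), IsCompact Θ → Θ₀ ⊆ Θ →
          ∀ (Ω : Type*) [MeasurableSpace Ω] (μ : Measure Ω) [IsProbabilityMeasure μ]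
            (X Y : ℕ → Ω → EuclideanSpace ℝ (Fin d)),
            (∀ i, HasLaw (X i) P μ) → iIndepFun X μ →
            (∀ j, HasLaw (Y j) Q μ) → iIndepFun Y μ →
            ∀ᵐ ω ∂μ,
              limsup (fun p : ℕ × ℕ =>
                ((InformationTheory.klDiv P Q : EReal) -
                  empiricalDV (fun i => X i ω) (fun j => Y j ω) p.1 p.2 (networkClass Θ)).abs)
                (atTop ×ˢ atTop) < ENNReal.ofReal ε := by

  -- The same function `f` is realised at all widths beyond `L₁` and `L₂`, so only `θ₀` depends on
  -- the widths.
  obtain ⟨f, ⟨L₁, L₂, hf⟩, hfε⟩ := exists_deepNetwork_klDiv_sub_lt (d := d) hR.ne (half_pos hε)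
  refine ⟨L₁, L₂, fun l₁ l₂ h₁ h₂ => ?_⟩
  obtain ⟨θ₀, rfl⟩ := hf l₁ l₂ h₁ h₂
  refine ⟨{θ₀}, Set.singleton_nonempty _, isCompact_singleton, ?_⟩
  intro Θ hΘ hΘ₀ Ω _ μ _ X Y hX hXi hY hYi
  have : CompactSpace Θ := isCompact_iff_compactSpace.1 hΘ
  have hP := integrable_networkEval (Θ := Θ) hP₁
  have hQ := integrable_expNetworkEval (Θ := Θ) hQ
  have hPθ (θ : Θ) : Integrable (network θ.1) P :=
    (ContinuousMap.evalCLM ℝ θ).integrable_comp hP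
  have hQθ (θ : Θ) : Integrable (fun x => Real.exp (network θ.1 x)) Q :=
    (ContinuousMap.evalCLM ℝ θ).integrable_comp hQ
  have hPe (θ : Θ) : (∫ x, networkEval Θ x ∂P) θ = ∫ x, network θ.1 x ∂P :=
    ((ContinuousMap.evalCLM ℝ θ).integral_comp_comm hP).symm
  have hQe (θ : Θ) : (∫ x, expNetworkEval Θ x ∂Q) θ = ∫ x, Real.exp (network θ.1 x) ∂Q :=
    ((ContinuousMap.evalCLM ℝ θ).integral_comp_comm hQ).symm
  filter_upwards [strong_law_ae_comp hX hXi (networkEval Θ).continuous hP,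
    strong_law_ae_comp hY hYi (expNetworkEval Θ).continuous hQ] with ω ha hb
  have hcoe : (InformationTheory.klDiv P Q : EReal)
      = ((InformationTheory.klDiv P Q).toReal : ℝ) := (EReal.coe_ennreal_toReal hR.ne).symm
  simp only [hcoe]
  refine limsup_abs_klDiv_sub_empiricalDV_lt hε ha hb (fun θ => ?_) (fun θ => ?_)
    ⟨θ₀, hΘ₀ rfl⟩ ?_
  · rw [hQe]
    exact integral_exp_pos (hQθ θ)
  · rw [hPe, hQe]
    exact integral_sub_log_integral_exp_le_klDiv hR.ne (hPθ θ) (hQθ θ)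
  · rw [hPe, hQe]
    exact hfε
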